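/- Let $(X,d)$ be a compact metric space with a base point $0\in X$, let $\mathbb{K}$ be $\mathbb{R}$ or $\mathbb{C}$, and let $\mathrm{Lip}_0(X)$ be the space of all Lipschitz functions $f\colon X\to\mathbb{K}$ with $f(0)=0$, normed by $$\mathrm{Lip}_d(f)=\sup\left\{\frac{|f(x)-f(y)|}{d(x,y)}\colon x,y\in X,\ x\neq y\right\}.$$ Let $\mathrm{lip}_0(X)$ be the subspace of $\mathrm{Lip}_0(X)$, with the same norm, of all $f$ that are supercontractive, i.e. such that for every $\varepsilon>0$ there is $\delta>0$ with $|f(x)-f(y)|/d(x,y)<\varepsilon$ whenever $x,y\in X$ and $0<d(x,y)<\delta$. Suppose that $\mathrm{lip}_0(X)$ separates points uniformly: there is a constant $a>1$ such that for all $x,y\in X$ there is $f\in\mathrm{lip}_0(X)$ with $\mathrm{Lip}_d(f)\le a$ and $|f(x)-f(y)|=d(x,y)$. Let $\phi\colon X\to X$ be a Lipschitz map with $\phi(0)=0$, and let $C_\phi\colon\mathrm{lip}_0(X)\to\mathrm{lip}_0(X)$ be the composition operator $C_\phi(f)=f\circ\phi$. If $C_\phi$ is weakly compact (the image of the closed unit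 ball is relatively compact in the weak topology of $\mathrm{lip}_0(X)$), then $C_\phi$ is compact. -/

import Mathlib

open Set

noncomputable section

namespace LipschitzSpaces

/-- A map between metric spaces is supercontractive if `d (f x) (f y) / d x y → 0` as
`d x y → 0`. -/
def Supercontractive {X Y : Type*} [MetricSpace X] [MetricSpace Y] (f : X → Y) : Prop :=
  ∀ ε : ℝ, 0 < ε → ∃ δ : ℝ, 0 < δ ∧
    ∀ x y : X, 0 < dist x y → dist x y < δ → dist (f x) (f y) / dist x y < ε

/-- The set of all difference quotients `|f x - f y| / d x y`, `x ≠ y`. -/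
def slopes {X 𝕜 : Type*} [MetricSpace X] [RCLike 𝕜] (f : X → 𝕜) : Set ℝ :=
  {r | ∃ x y : X, x ≠ y ∧ r = ‖f x - f y‖ / dist x y}

/-- The Lipschitz number `Lip_d f`, the supremum of the difference quotients of `f`
(it is `0` on a one-point space). -/
def lipNumber {X 𝕜 : Type*} [MetricSpace X] [RCLike 𝕜] (f : X → 𝕜) : ℝ :=
  sSup (slopes f)

section Space

variable {X : Type*} [MetricSpace X] (𝕜 : Type*) [RCLike 𝕜] (x₀ : X)

/-- The scalar-valued Lipschitz functions vanishing at the base point `x₀`, as a linear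
subspace of the space of all functions. -/
def lipZeroSubmodule : Submodule 𝕜 (X → 𝕜) where
  carrier := {f | (∃ K, LipschitzWith K f) ∧ f x₀ = 0}
  zero_mem' := ⟨⟨0, LipschitzWith.const 0⟩, rfl⟩
  add_mem' := by
    rintro f g ⟨⟨K, hK⟩, hf⟩ ⟨⟨L, hL⟩, hg⟩
    exact ⟨⟨K + L, hK.add hL⟩, by simp [hf, hg]⟩
  smul_mem' := by
    rintro c f ⟨⟨K, hK⟩, hf⟩
    refine ⟨⟨‖c‖₊ * K, LipschitzWith.of_dist_le_mul fun x y => ?_⟩, by simp [hf]⟩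
    have h := hK.dist_le_mul x y
    simp only [Pi.smul_apply, dist_smul₀, NNReal.coe_mul, coe_nnnorm]
    calc ‖c‖ * dist (f x) (f y) ≤ ‖c‖ * (K * dist x y) := by gcongr
      _ = ‖c‖ * K * dist x y := by ring

/-- The Lipschitz space `Lip₀(X)`. It is a separate type, so that it carries the Lipschitz norm
and not the topology of pointwise convergence. -/
def LipZero : Type _ := lipZeroSubmodule 𝕜 x₀

instance : AddCommGroup (LipZero 𝕜 x₀) := inferInstanceAs (AddCommGroup (lipZeroSubmodule 𝕜 x₀))

instance : Module 𝕜 (LipZero 𝕜 x₀) := inferInstanceAs (Module 𝕜 (lipZeroSubmodule 𝕜 x₀))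

end Space

namespace LipZero

variable {X : Type*} [MetricSpace X] {𝕜 : Type*} [RCLike 𝕜] {x₀ : X}

instance : FunLike (LipZero 𝕜 x₀) X 𝕜 where
  coe f := f.1
  coe_injective _ _ h := Subtype.ext h

/-- The element of `Lip₀(X)` given by a Lipschitz function vanishing at `x₀`. -/
def mk (f : X → 𝕜) (hf : ∃ K, LipschitzWith K f) (h0 : f x₀ = 0) : LipZero 𝕜 x₀ := ⟨f, hf, h0⟩

@[simp] theorem mk_apply (f : X → 𝕜) (hf : ∃ K, LipschitzWith K f) (h0 : f x₀ = 0) (x : X) :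
    mk f hf h0 x = f x := rfl

@[simp] theorem zero_apply (x : X) : (0 : LipZero 𝕜 x₀) x = 0 := rfl

@[simp] theorem add_apply (f g : LipZero 𝕜 x₀) (x : X) : (f + g) x = f x + g x := rfl

@[simp] theorem neg_apply (f : LipZero 𝕜 x₀) (x : X) : (-f) x = -f x := rfl

@[simp] theorem sub_apply (f g : LipZero 𝕜 x₀) (x : X) : (f - g) x = f x - g x := rfl

@[simp] theorem smul_apply (c : 𝕜) (f : LipZero 𝕜 x₀) (x : X) : (c • f) x = c * f x := rfl

@[ext] theorem ext {f g : LipZero 𝕜 x₀} (h : ∀ x, f x = g x) : f = g := DFunLike.ext _ _ h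

theorem exists_lipschitzWith (f : LipZero 𝕜 x₀) : ∃ K, LipschitzWith K f := f.2.1

@[simp] theorem apply_base (f : LipZero 𝕜 x₀) : f x₀ = 0 := f.2.2

theorem bddAbove_slopes (f : LipZero 𝕜 x₀) : BddAbove (slopes f) := by
  obtain ⟨K, hK⟩ := f.exists_lipschitzWith
  refine ⟨K, ?_⟩
  rintro r ⟨x, y, hxy, rfl⟩
  rw [div_le_iff₀ (dist_pos.2 hxy), ← dist_eq_norm]
  exact hK.dist_le_mul x y

theorem lipNumber_nonneg (f : X → 𝕜) : 0 ≤ lipNumber f := by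
  refine Real.sSup_nonneg ?_
  rintro r ⟨x, y, -, rfl⟩
  positivity

theorem norm_sub_le (f : LipZero 𝕜 x₀) (x y : X) : ‖f x - f y‖ ≤ lipNumber f * dist x y := by
  rcases eq_or_ne x y with rfl | hxy
  · simp
  · rw [← div_le_iff₀ (dist_pos.2 hxy)]
    exact le_csSup f.bddAbove_slopes ⟨x, y, hxy, rfl⟩

theorem lipNumber_le {f : X → 𝕜} {M : ℝ} (hM : 0 ≤ M)
    (h : ∀ x y, ‖f x - f y‖ ≤ M * dist x y) : lipNumber f ≤ M := by
  refine Real.sSup_le ?_ hM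
  rintro r ⟨x, y, hxy, rfl⟩
  rw [div_le_iff₀ (dist_pos.2 hxy)]
  exact h x y

/-- `Lip₀(X)` is normed by the Lipschitz number. -/
instance : NormedAddCommGroup (LipZero 𝕜 x₀) :=
  AddGroupNorm.toNormedAddCommGroup
    { toFun := fun f => lipNumber f
      map_zero' := le_antisymm (lipNumber_le le_rfl (by simp)) (lipNumber_nonneg _)
      add_le' := fun f g => by
        refine lipNumber_le (add_nonneg (lipNumber_nonneg _) (lipNumber_nonneg _)) fun x y => ?_
        have h1 := f.norm_sub_le x y
        have h2 := g.norm_sub_le x y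
        have h3 : (f + g) x - (f + g) y = (f x - f y) + (g x - g y) := by simp; ring
        rw [h3, add_mul]
        exact (norm_add_le _ _).trans (add_le_add h1 h2)
      neg' := fun f => by
        have h : slopes (-f : LipZero 𝕜 x₀) = slopes f := by
          ext r
          simp only [slopes, mem_ofPred_eq, neg_apply, neg_sub_neg, norm_sub_rev]
        simp only [lipNumber, h]
      eq_zero_of_map_eq_zero' := fun f hf => by
        ext x
        have h := f.norm_sub_le x x₀
        have hf' : lipNumber f = 0 := hf
        simpa [hf'] using h }

theorem norm_def (f : LipZero 𝕜 x₀) : ‖f‖ = lipNumber f := rfl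

instance : NormedSpace 𝕜 (LipZero 𝕜 x₀) where
  norm_smul_le c f := by
    refine lipNumber_le (by positivity) fun x y => ?_
    rw [smul_apply, smul_apply, ← mul_sub, norm_mul, mul_assoc]
    exact mul_le_mul_of_nonneg_left (f.norm_sub_le x y) (norm_nonneg c)

end LipZero

section Little

variable {X : Type*} [MetricSpace X] (𝕜 : Type*) [RCLike 𝕜] (x₀ : X)

/-- The little Lipschitz space `lip₀(X)`: the subspace of the supercontractive functions in
`Lip₀(X)`, with the norm of `Lip₀(X)`. -/
def littleLipZero : Submodule 𝕜 (LipZero 𝕜 x₀) where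
  carrier := {f | Supercontractive f}
  zero_mem' := fun ε hε => ⟨1, one_pos, fun x y _ _ => by simpa using hε⟩
  add_mem' := by
    intro f g hf hg ε hε
    obtain ⟨δ₁, hδ₁, h₁⟩ := hf (ε / 2) (half_pos hε)
    obtain ⟨δ₂, hδ₂, h₂⟩ := hg (ε / 2) (half_pos hε)
    refine ⟨min δ₁ δ₂, lt_min hδ₁ hδ₂, fun x y hxy hd => ?_⟩
    have a₁ := h₁ x y hxy (hd.trans_le (min_le_left _ _))
    have a₂ := h₂ x y hxy (hd.trans_le (min_le_right _ _))
    have h : dist ((f + g) x) ((f + g) y) ≤ dist (f x) (f y) + dist (g x) (g y) :=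
      dist_add_add_le _ _ _ _
    calc dist ((f + g) x) ((f + g) y) / dist x y
        ≤ (dist (f x) (f y) + dist (g x) (g y)) / dist x y := by gcongr
      _ = dist (f x) (f y) / dist x y + dist (g x) (g y) / dist x y := add_div _ _ _
      _ < ε := by linarith
  smul_mem' := by
    intro c f hf ε hε
    have hc : 0 < ‖c‖ + 1 := by positivity
    obtain ⟨δ, hδ, h⟩ := hf (ε / (‖c‖ + 1)) (div_pos hε hc)
    refine ⟨δ, hδ, fun x y hxy hd => ?_⟩
    have a := h x y hxy hd
    rw [lt_div_iff₀ hc] at a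
    have e : dist ((c • f) x) ((c • f) y) = ‖c‖ * dist (f x) (f y) := by
      rw [LipZero.smul_apply, LipZero.smul_apply, dist_eq_norm, dist_eq_norm, ← mul_sub, norm_mul]
    rw [e, mul_div_assoc]
    have hn : 0 ≤ dist (f x) (f y) / dist x y := by positivity
    linarith

/-- `lip₀(X)` separates points uniformly. As every `f` in `lip₀(X)` vanishes at the base point,
only the difference `f x - f y` is prescribed: asking for `f y = 0` for all `y` as well could
be met on a one-point space only. -/
def SeparatesPointsUniformly : Prop :=
  ∃ a : ℝ, 1 < a ∧ ∀ x y : X, ∃ f : LipZero 𝕜 x₀, f ∈ littleLipZero 𝕜 x₀ ∧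
    lipNumber f ≤ a ∧ ‖f x - f y‖ = dist x y

end Little

section Composition

variable {X : Type*} [MetricSpace X] (𝕜 : Type*) [RCLike 𝕜] {x₀ : X} {φ : X → X}

theorem Supercontractive.comp_lipschitz {Y : Type*} [MetricSpace Y] {f : X → Y}
    (hf : Supercontractive f) (hφ : ∃ K, LipschitzWith K φ) : Supercontractive (f ∘ φ) := by
  obtain ⟨K, hK⟩ := hφ
  intro ε hε
  have hK1 : (0 : ℝ) < K + 1 := by positivity
  obtain ⟨δ, hδ, h⟩ := hf (ε / (K + 1)) (div_pos hε hK1)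
  refine ⟨δ / (K + 1), div_pos hδ hK1, fun x y hxy hd => ?_⟩
  have hl := hK.dist_le_mul x y
  have hl' : dist (φ x) (φ y) ≤ (K + 1) * dist x y := by linarith
  rw [div_lt_iff₀ hxy]
  rcases (dist_nonneg (x := φ x) (y := φ y)).eq_or_lt with h0 | h0
  · have e : φ x = φ y := dist_eq_zero.1 h0.symm
    simp only [Function.comp_apply, e, dist_self]
    positivity
  · rw [lt_div_iff₀ hK1] at hd
    have a := h _ _ h0 (by linarith)
    rw [div_lt_iff₀ h0] at a
    calc dist ((f ∘ φ) x) ((f ∘ φ) y) < ε / (K + 1) * dist (φ x) (φ y) := a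
      _ ≤ ε / (K + 1) * ((K + 1) * dist x y) := by gcongr
      _ = ε * dist x y := by field_simp

/-- The composition operator `C_φ f = f ∘ φ` on `lip₀(X)`, for a Lipschitz map `φ : X → X`
preserving the base point, as a bounded linear operator. -/
def compOperator (hφ : ∃ K, LipschitzWith K φ) (h0 : φ x₀ = x₀) :
    littleLipZero 𝕜 x₀ →L[𝕜] littleLipZero 𝕜 x₀ :=
  LinearMap.mkContinuousOfExistsBound
    { toFun := fun f =>
        ⟨LipZero.mk (f.1 ∘ φ)
          (by
            obtain ⟨K, hK⟩ := hφ
            obtain ⟨L, hL⟩ := f.1.exists_lipschitzWith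
            exact ⟨L * K, hL.comp hK⟩)
          (by simp [h0]),
        (show Supercontractive f.1 from f.2).comp_lipschitz hφ⟩
      map_add' := fun _ _ => rfl
      map_smul' := fun _ _ => rfl }
    (by
      obtain ⟨K, hK⟩ := hφ
      refine ⟨K, fun f => LipZero.lipNumber_le (by positivity) fun x y => ?_⟩
      refine (f.1.norm_sub_le (φ x) (φ y)).trans ?_
      calc lipNumber f.1 * dist (φ x) (φ y) ≤ lipNumber f.1 * (K * dist x y) :=
            mul_le_mul_of_nonneg_left (hK.dist_le_mul x y) (LipZero.lipNumber_nonneg _)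
        _ = K * lipNumber f.1 * dist x y := by ring)

@[simp] theorem compOperator_apply (hφ : ∃ K, LipschitzWith K φ) (h0 : φ x₀ = x₀)
    (f : littleLipZero 𝕜 x₀) (x : X) : (compOperator 𝕜 hφ h0 f).1 x = f.1 (φ x) := rfl

end Composition

/-- A bounded linear operator is weakly compact if it maps the closed unit ball onto a relatively
compact set for the weak topology of the codomain. -/
def IsWeaklyCompactOperator {𝕜 E F : Type*} [RCLike 𝕜] [NormedAddCommGroup E] [NormedSpace 𝕜 E]
    [NormedAddCommGroup F] [NormedSpace 𝕜 F] (T : E →L[𝕜] F) : Prop :=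
  IsCompact (closure ((fun e => toWeakSpace 𝕜 F (T e)) '' Metric.closedBall (0 : E) 1))

end LipschitzSpaces

end

/-!
The property linking weak compactness of `C_φ` to compactness is supercontractivity of `φ`.

If `φ` is supercontractive, `f ↦ f ∘ φ` maps the unit ball of `Lip₀(X)`, which is compact for the
supremum metric by Arzelà–Ascoli, continuously into `lip₀(X)` with its norm: difference quotients
at small distances are uniformly small, and those at distance at least `δ` are controlled by the
supremum norm. So `C_φ` is compact
(`Supercontractive.isCompactOperator_compOperator`).

Conversely, let `C_φ` be weakly compact. Uniform separation and the lattice structure of real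
supercontractive functions give, for each nonexpansive real `f`, interpolants of `f` on finite sets
that are bounded in `lip₀(X)` (`exists_mem_littleLipBall_eqOn`). As evaluations are weakly
continuous, the finite intersection property in the weakly compact closure of the image of the unit
ball shows that `f ∘ φ` itself is supercontractive
(`supercontractive_comp_of_isWeaklyCompactOperator`). Thus the bidual of `lip₀(X)` does not enter.
A Baire category argument on the complete space of nonexpansive real functions then makes this
uniform enough to yield supercontractivity of `φ` (`supercontractive_of_forall_comp`).
-/


noncomputable section

namespace LipschitzSpaces

/-! ### Real supercontractive functions and interpolation on finite sets -/

section Interpolation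

variable {X : Type*} [MetricSpace X]

theorem Supercontractive.of_dist_le {Y Z : Type*} [MetricSpace Y] [MetricSpace Z]
    {f : X → Y} {g : X → Z} (hf : Supercontractive f)
    (h : ∀ u v, dist (g u) (g v) ≤ dist (f u) (f v)) : Supercontractive g := by
  intro ε hε
  obtain ⟨δ, hδ, H⟩ := hf ε hε
  refine ⟨δ, hδ, fun x y hxy hd => lt_of_le_of_lt ?_ (H x y hxy hd)⟩
  gcongr
  exact h x y

theorem Supercontractive.of_dist_le_max {W Y Z : Type*} [MetricSpace W] [MetricSpace Y]
    [MetricSpace Z] {e : X → W} {f : X → Y} {g : X → Z} (he : Supercontractive e)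
    (hf : Supercontractive f)
    (h : ∀ u v, dist (g u) (g v) ≤ max (dist (e u) (e v)) (dist (f u) (f v))) :
    Supercontractive g := by
  intro ε hε
  obtain ⟨δ₁, hδ₁, H₁⟩ := he ε hε
  obtain ⟨δ₂, hδ₂, H₂⟩ := hf ε hε
  refine ⟨min δ₁ δ₂, lt_min hδ₁ hδ₂, fun x y hxy hd => ?_⟩
  have a₁ := H₁ x y hxy (hd.trans_le (min_le_left _ _))
  have a₂ := H₂ x y hxy (hd.trans_le (min_le_right _ _))
  rw [div_lt_iff₀ hxy] at *
  exact (h x y).trans_lt (max_lt a₁ a₂)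

/-- The real-valued supercontractive functions with Lipschitz constant `a`. They form a
sublattice of `X → ℝ`. -/
def littleLipBall (X : Type*) [MetricSpace X] (a : ℝ) : Set (X → ℝ) :=
  {h | Supercontractive h ∧ ∀ u v, dist (h u) (h v) ≤ a * dist u v}

theorem sup_mem_littleLipBall {a : ℝ} {f g : X → ℝ} (hf : f ∈ littleLipBall X a)
    (hg : g ∈ littleLipBall X a) : f ⊔ g ∈ littleLipBall X a := by
  have key : ∀ u v, dist ((f ⊔ g) u) ((f ⊔ g) v) ≤ max (dist (f u) (f v)) (dist (g u) (g v)) :=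
    fun u v => abs_max_sub_max_le_max _ _ _ _
  exact ⟨hf.1.of_dist_le_max hg.1 key,
    fun u v => (key u v).trans (max_le (hf.2 u v) (hg.2 u v))⟩

theorem inf_mem_littleLipBall {a : ℝ} {f g : X → ℝ} (hf : f ∈ littleLipBall X a)
    (hg : g ∈ littleLipBall X a) : f ⊓ g ∈ littleLipBall X a := by
  have key : ∀ u v, dist ((f ⊓ g) u) ((f ⊓ g) v) ≤ max (dist (f u) (f v)) (dist (g u) (g v)) :=
    fun u v => abs_min_sub_min_le_max _ _ _ _
  exact ⟨hf.1.of_dist_le_max hg.1 key,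
    fun u v => (key u v).trans (max_le (hf.2 u v) (hg.2 u v))⟩

/-- Uniform separation by scalar functions gives uniform separation by real ones: multiply by a
unimodular scalar and take the real part. -/
theorem SeparatesPointsUniformly.exists_real {𝕜 : Type*} [RCLike 𝕜] {x₀ : X}
    (hsep : SeparatesPointsUniformly 𝕜 x₀) :
    ∃ a : ℝ, 0 < a ∧ ∀ x y : X, ∃ h ∈ littleLipBall X a, h x - h y = dist x y := by
  obtain ⟨a, ha, H⟩ := hsep
  refine ⟨a, by linarith, fun x y => ?_⟩
  obtain ⟨f, hf, hfa, hfxy⟩ := H x y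
  obtain ⟨c, hc, hcf⟩ := RCLike.exists_norm_eq_mul_self (f x - f y)
  have key : ∀ u v, dist (RCLike.re (c * f u)) (RCLike.re (c * f v)) ≤ dist (f u) (f v) := by
    intro u v
    rw [Real.dist_eq, ← map_sub, ← mul_sub, dist_eq_norm]
    refine (RCLike.abs_re_le_norm _).trans ?_
    rw [norm_mul, hc, one_mul]
  refine ⟨fun z => RCLike.re (c * f z), ⟨Supercontractive.of_dist_le hf key, fun u v => ?_⟩, ?_⟩
  · refine (key u v).trans ?_
    rw [dist_eq_norm]
    exact (f.norm_sub_le u v).trans (by gcongr)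
  · show RCLike.re (c * f x) - RCLike.re (c * f y) = dist x y
    rw [← map_sub, ← mul_sub, ← hcf, RCLike.ofReal_re, hfxy]

/-- A nonexpansive real function is matched at two given points by a separating function. -/
theorem exists_mem_littleLipBall_eq_pair {a : ℝ}
    (H : ∀ x y : X, ∃ h ∈ littleLipBall X a, h x - h y = dist x y)
    {f : X → ℝ} (hf : LipschitzWith 1 f) (x y : X) :
    ∃ g ∈ littleLipBall X a, g x = f x ∧ g y = f y := by
  obtain ⟨h, ⟨hs, hl⟩, hxy⟩ := H x y
  set c : ℝ := (f x - f y) / dist x y with hc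
  have hd := hf.dist_le_mul x y
  rw [Real.dist_eq, NNReal.coe_one, one_mul] at hd
  have hc1 : |c| ≤ 1 := by
    rw [hc, abs_div, abs_of_nonneg dist_nonneg]
    exact div_le_one_of_le₀ hd dist_nonneg
  have key : ∀ u v, dist (f x + c * (h u - h x)) (f x + c * (h v - h x)) ≤ dist (h u) (h v) := by
    intro u v
    have e : f x + c * (h u - h x) - (f x + c * (h v - h x)) = c * (h u - h v) := by ring
    rw [Real.dist_eq, Real.dist_eq, e, abs_mul]
    exact mul_le_of_le_one_left (abs_nonneg _) hc1
  refine ⟨fun z => f x + c * (h z - h x),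
    ⟨hs.of_dist_le key, fun u v => (key u v).trans (hl u v)⟩, by simp, ?_⟩
  rcases eq_or_ne x y with rfl | hne
  · simp
  · have e : h y - h x = -dist x y := by linarith
    have hne' := (dist_pos.2 hne).ne'
    simp only [e, hc]
    field_simp
    ring

/-- If real supercontractive functions with constant `a` separate points, they interpolate
nonexpansive functions on finite sets, by `max_x min_y g_{xy}` where `g_{xy}` agrees with `f`
at `x` and `y`. -/
theorem exists_mem_littleLipBall_eqOn {a : ℝ}
    (H : ∀ x y : X, ∃ h ∈ littleLipBall X a, h x - h y = dist x y)
    {f : X → ℝ} (hf : LipschitzWith 1 f) (F : Finset X) (hF : F.Nonempty) :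
    ∃ g ∈ littleLipBall X a, ∀ z ∈ F, g z = f z := by
  choose g hg hgx hgy using exists_mem_littleLipBall_eq_pair H hf
  have h₁ : ∀ x, F.inf' hF (g x) ∈ littleLipBall X a := fun x =>
    Finset.inf'_mem _ (fun u hu v hv => inf_mem_littleLipBall hu hv) F hF _ fun y _ => hg x y
  refine ⟨F.sup' hF fun x => F.inf' hF (g x),
    Finset.sup'_mem _ (fun u hu v hv => sup_mem_littleLipBall hu hv) F hF _ fun x _ => h₁ x,
    fun z hz => ?_⟩
  rw [Finset.sup'_apply]
  simp only [Finset.inf'_apply]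
  refine le_antisymm (Finset.sup'_le _ _ fun x _ => ?_) (le_trans ?_ (Finset.le_sup' _ hz))
  · exact (Finset.inf'_le _ hz).trans (hgy x z).le
  · exact Finset.le_inf' _ _ fun y _ => (hgx z y).ge

end Interpolation

/-! ### Weak compactness sends Lipschitz functions to supercontractive ones -/

section WeakCompactness

variable {X : Type*} [MetricSpace X] {𝕜 : Type*} [RCLike 𝕜] {x₀ : X} {φ : X → X}

/-- Evaluation at a point, as a bounded linear functional on `lip₀(X)`. -/
def evalCLM (𝕜 : Type*) [RCLike 𝕜] (x₀ x : X) : littleLipZero 𝕜 x₀ →L[𝕜] 𝕜 :=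
  LinearMap.mkContinuous
    { toFun := fun f => f.1 x
      map_add' := fun _ _ => rfl
      map_smul' := fun _ _ => rfl } (dist x x₀) fun f => by
    have h := f.1.norm_sub_le x x₀
    rw [f.1.apply_base, sub_zero] at h
    rw [mul_comm]
    exact h

theorem continuous_weakSpace_apply (x : X) :
    Continuous fun w : WeakSpace 𝕜 (littleLipZero 𝕜 x₀) => ((toWeakSpace 𝕜 _).symm w).1 x :=
  WeakBilin.eval_continuous (topDualPairing 𝕜 (littleLipZero 𝕜 x₀)).flip (evalCLM 𝕜 x₀ x)

/-- If `C_φ` is weakly compact, then `f ∘ φ` is supercontractive for every nonexpansive real `f`: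
interpolants of `f` on finite sets are bounded in `lip₀(X)`, and a weak cluster point of their
images under `C_φ` is a multiple of `f ∘ φ`, up to a constant. -/
theorem supercontractive_comp_of_isWeaklyCompactOperator
    (hφ : ∃ K, LipschitzWith K φ) (h0 : φ x₀ = x₀) (hsep : SeparatesPointsUniformly 𝕜 x₀)
    (hweak : IsWeaklyCompactOperator (compOperator 𝕜 hφ h0))
    {f : X → ℝ} (hf : LipschitzWith 1 f) : Supercontractive (f ∘ φ) := by
  classical
  obtain ⟨a, ha, H⟩ := hsep.exists_real
  have ha' : (a : 𝕜) ≠ 0 := RCLike.ofReal_ne_zero.2 ha.ne'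
  obtain ⟨w, -, hw⟩ := hweak.inter_iInter_nonempty
    (fun x : X => {w : WeakSpace 𝕜 (littleLipZero 𝕜 x₀) |
      ((toWeakSpace 𝕜 _).symm w).1 x = (a : 𝕜)⁻¹ * ((f (φ x) - f x₀ : ℝ) : 𝕜)})
    (fun x => isClosed_eq (continuous_weakSpace_apply x) continuous_const) (by
      intro u
      obtain ⟨g, ⟨hgs, hgl⟩, hgf⟩ := exists_mem_littleLipBall_eqOn H hf
        (insert x₀ (u.image φ)) (Finset.insert_nonempty _ _)
      have hg0 : g x₀ = f x₀ := hgf _ (Finset.mem_insert_self _ _)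
      have key : ∀ s t, ‖(a : 𝕜)⁻¹ * ((g s - g x₀ : ℝ) : 𝕜) -
          (a : 𝕜)⁻¹ * ((g t - g x₀ : ℝ) : 𝕜)‖ = a⁻¹ * dist (g s) (g t) := by
        intro s t
        rw [← mul_sub, norm_mul, ← RCLike.ofReal_sub, RCLike.norm_ofReal, norm_inv,
          RCLike.norm_ofReal, abs_of_pos ha, Real.dist_eq]
        congr 2
        ring
      have key1 : ∀ s t, ‖(a : 𝕜)⁻¹ * ((g s - g x₀ : ℝ) : 𝕜) -
          (a : 𝕜)⁻¹ * ((g t - g x₀ : ℝ) : 𝕜)‖ ≤ 1 * dist s t := by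
        intro s t
        rw [key, inv_mul_le_iff₀ ha, one_mul]
        exact hgl s t
      have hs : Supercontractive fun z => (a : 𝕜)⁻¹ * ((g z - g x₀ : ℝ) : 𝕜) := by
        intro ε hε
        obtain ⟨δ, hδ, h⟩ := hgs (a * ε) (by positivity)
        refine ⟨δ, hδ, fun x y hxy hd => ?_⟩
        rw [dist_eq_norm, key, mul_div_assoc, inv_mul_lt_iff₀ ha]
        exact h x y hxy hd
      let k : littleLipZero 𝕜 x₀ :=
        ⟨LipZero.mk (fun z => (a : 𝕜)⁻¹ * ((g z - g x₀ : ℝ) : 𝕜))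
          ⟨1, LipschitzWith.of_dist_le_mul fun s t => by rw [dist_eq_norm]; exact key1 s t⟩
          (by simp), hs⟩
      refine ⟨toWeakSpace 𝕜 _ (compOperator 𝕜 hφ h0 k),
        subset_closure ⟨k, mem_closedBall_zero_iff.2 ?_, rfl⟩, ?_⟩
      · exact LipZero.lipNumber_le zero_le_one key1
      · simp only [mem_iInter]
        intro x hx
        have hgx := hgf (φ x) (Finset.mem_insert_of_mem (Finset.mem_image_of_mem φ hx))
        show (a : 𝕜)⁻¹ * ((g (φ x) - g x₀ : ℝ) : 𝕜) = _
        rw [hgx, hg0])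
  simp only [mem_iInter] at hw
  intro ε hε
  obtain ⟨δ, hδ, h⟩ := ((toWeakSpace 𝕜 _).symm w).2 (a⁻¹ * ε) (by positivity)
  refine ⟨δ, hδ, fun x y hxy hd => ?_⟩
  have h1 := h x y hxy hd
  have ex : ((toWeakSpace 𝕜 _).symm w).1 x = (a : 𝕜)⁻¹ * ((f (φ x) - f x₀ : ℝ) : 𝕜) := hw x
  have ey : ((toWeakSpace 𝕜 _).symm w).1 y = (a : 𝕜)⁻¹ * ((f (φ y) - f x₀ : ℝ) : 𝕜) := hw y
  rw [ex, ey, dist_eq_norm, ← mul_sub, norm_mul, ← RCLike.ofReal_sub, RCLike.norm_ofReal,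
    norm_inv, RCLike.norm_ofReal, abs_of_pos ha, sub_sub_sub_cancel_right, mul_div_assoc] at h1
  exact lt_of_mul_lt_mul_left h1 (by positivity)

end WeakCompactness

/-! ### A uniformity argument by Baire category -/

section Baire

open BoundedContinuousFunction

theorem isClosed_setOf_lipschitzWith {X Y : Type*} [MetricSpace X] [MetricSpace Y] (K : NNReal) :
    IsClosed {f : X →ᵇ Y | LipschitzWith K f} := by
  simp only [lipschitzWith_iff_dist_le_mul, ofPred_forall]
  exact isClosed_iInter fun x => isClosed_iInter fun y => isClosed_le
    ((continuous_eval_const x).dist (continuous_eval_const y)) continuous_const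

variable {X : Type*} [MetricSpace X] [CompactSpace X] {φ : X → X}

/-- If `f ∘ φ` is supercontractive for every nonexpansive real `f`, then so is `φ`. By Baire,
supercontractivity of `f ∘ φ` is uniform near some nonexpansive `f`. Near `f` there is also
`max f (f p + d p q - d · p)`, where `p = φ x` and `q = φ y`, and one of these two functions
changes by at least `d p q / 2` between `p` and `q`. -/
theorem supercontractive_of_forall_comp (hφ : ∃ K, LipschitzWith K φ)
    (H : ∀ f : X → ℝ, LipschitzWith 1 f → Supercontractive (f ∘ φ)) : Supercontractive φ := by
  intro ε hε
  obtain ⟨K, hK⟩ := hφ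
  let B : Set (X →ᵇ ℝ) := {f | LipschitzWith 1 f}
  have hB : IsClosed B := isClosed_setOf_lipschitzWith 1
  have : CompleteSpace B := hB.completeSpace_coe
  have : Nonempty B := ⟨⟨0, LipschitzWith.const' 0⟩⟩
  let F : ℕ → Set B := fun N =>
    {f | ∀ x y, dist x y < 1 / ((N : ℝ) + 1) →
      dist (f.1 (φ x)) (f.1 (φ y)) ≤ ε / 3 * dist x y}
  have hFc : ∀ N, IsClosed (F N) := by
    intro N
    simp only [F, ofPred_forall]
    exact isClosed_iInter fun x => isClosed_iInter fun y => isClosed_iInter fun _ => isClosed_le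
      (((continuous_eval_const (φ x)).comp continuous_subtype_val).dist
        ((continuous_eval_const (φ y)).comp continuous_subtype_val)) continuous_const
  have hFU : ⋃ N, F N = univ := by
    refine eq_univ_of_forall fun f => ?_
    obtain ⟨δ, hδ, h⟩ := H f.1 f.2 (ε / 3) (by positivity)
    obtain ⟨N, hN⟩ := exists_nat_one_div_lt hδ
    refine mem_iUnion.2 ⟨N, fun x y hd => ?_⟩
    rcases eq_or_ne x y with rfl | hne
    · simp
    · rw [← div_le_iff₀ (dist_pos.2 hne)]
      exact (h x y (dist_pos.2 hne) (hd.trans hN)).le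
  obtain ⟨N, f, hf⟩ := nonempty_interior_of_iUnion_of_closed hFc hFU
  obtain ⟨η, hη, hball⟩ := Metric.mem_nhds_iff.1 (mem_interior_iff_mem_nhds.1 hf)
  refine ⟨min (1 / ((N : ℝ) + 1)) (η / (K + 1)),
    lt_min (by positivity) (by positivity), fun x y hxy hd => ?_⟩
  have hd1 := hd.trans_le (min_le_left _ _)
  have hd2 := hd.trans_le (min_le_right _ _)
  rw [lt_div_iff₀ (by positivity)] at hd2
  have hKd := hK.dist_le_mul x y
  set p := φ x with hp
  set q := φ y with hq
  have hrη : dist p q < η := by linarith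
  have hfl : LipschitzWith 1 f.1 := f.2
  have hgl : LipschitzWith 1 fun z => max (f.1 z) (f.1 p + dist p q - dist z p) := by
    have h2 : LipschitzWith 1 fun z => f.1 p + dist p q - dist z p :=
      LipschitzWith.of_dist_le_mul fun u v => by
        rw [dist_sub_left]
        exact (LipschitzWith.dist_left p).dist_le_mul u v
    simpa using hfl.max h2
  let g : X →ᵇ ℝ := BoundedContinuousFunction.mkOfCompact ⟨_, hgl.continuous⟩
  have hg : ∀ z, g z = max (f.1 z) (f.1 p + dist p q - dist z p) := fun z => rfl
  have hgf : dist g f.1 ≤ dist p q := by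
    refine (BoundedContinuousFunction.dist_le dist_nonneg).2 fun z => ?_
    have h1 := hfl.dist_le_mul z p
    rw [NNReal.coe_one, one_mul, Real.dist_eq, abs_le] at h1
    rw [hg, Real.dist_eq, abs_le]
    refine ⟨?_, ?_⟩
    · linarith [le_max_left (f.1 z) (f.1 p + dist p q - dist z p), dist_nonneg (x := p) (y := q)]
    · rw [sub_le_iff_le_add]
      exact max_le (by linarith [dist_nonneg (x := p) (y := q)]) (by linarith)
  have hgF : (⟨g, hgl⟩ : B) ∈ F N := hball (lt_of_le_of_lt hgf hrη)
  have hfF : f ∈ F N := interior_subset hf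
  have e1 := hgF x y hd1
  have e2 := hfF x y hd1
  have e3 : f.1 p + dist p q ≤ g p := by
    rw [hg, dist_self, sub_zero]; exact le_max_right _ _
  have e4 : g q = max (f.1 q) (f.1 p) := by
    rw [hg, dist_comm q p, add_sub_cancel_right]
  rw [Real.dist_eq, abs_le] at e1 e2
  have e5 : g q ≤ f.1 p + ε / 3 * dist x y := by
    rw [e4]
    have : 0 ≤ ε / 3 * dist x y := by positivity
    exact max_le (by linarith [e2.1]) (by linarith)
  have e6 : g p - g q ≤ ε / 3 * dist x y := e1.2
  rw [div_lt_iff₀ hxy]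
  have : 0 < ε * dist x y := by positivity
  -- `e3`, `e5` and `e6` give `dist p q ≤ 2 / 3 * ε * dist x y`.
  linarith

end Baire

/-! ### Supercontractive maps induce compact composition operators -/

section Compactness

open BoundedContinuousFunction

variable {X : Type*} [MetricSpace X] [CompactSpace X] {𝕜 : Type*} [RCLike 𝕜] {x₀ : X} {φ : X → X}

theorem isCompact_setOf_lipschitzWith_one (𝕜 : Type*) [RCLike 𝕜] (x₀ : X) :
    IsCompact {f : X →ᵇ 𝕜 | f x₀ = 0 ∧ LipschitzWith 1 f} := by
  refine arzela_ascoli₂ (Metric.closedBall 0 (Metric.diam (univ : Set X)))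
    (isCompact_closedBall _ _) _ ?_ ?_ ?_
  · exact (isClosed_eq (continuous_eval_const x₀) continuous_const).inter
      (isClosed_setOf_lipschitzWith 1)
  · rintro f x ⟨h0, hf⟩
    rw [Metric.mem_closedBall, ← h0]
    refine (hf.dist_le_mul x x₀).trans ?_
    rw [NNReal.coe_one, one_mul]
    exact Metric.dist_le_diam_of_mem isCompact_univ.isBounded (mem_univ _) (mem_univ _)
  · exact (LipschitzWith.uniformEquicontinuous _ 1 fun f => f.2.2).equicontinuous

/-- If `φ` is supercontractive, `f ↦ f ∘ φ` is continuous from the unit ball of `Lip₀(X)` with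
the supremum metric, which is compact, to `lip₀(X)`. -/
theorem Supercontractive.isCompactOperator_compOperator (hs : Supercontractive φ)
    (hφ : ∃ K, LipschitzWith K φ) (h0 : φ x₀ = x₀) :
    IsCompactOperator (compOperator 𝕜 hφ h0) := by
  let B : Set (X →ᵇ 𝕜) := {f | f x₀ = 0 ∧ LipschitzWith 1 f}
  have : CompactSpace B := isCompact_iff_compactSpace.1 (isCompact_setOf_lipschitzWith_one 𝕜 x₀)
  have hlip : ∀ (f : B) (u v : X), dist (f.1 u) (f.1 v) ≤ dist u v := fun f u v => by
    simpa using f.2.2.dist_le_mul u v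
  let Φ : B → littleLipZero 𝕜 x₀ := fun f =>
    ⟨LipZero.mk (fun z => f.1 (φ z))
      (by obtain ⟨K, hK⟩ := hφ; exact ⟨1 * K, f.2.2.comp hK⟩)
      (by simp only [h0]; exact f.2.1),
      hs.of_dist_le fun u v => hlip f (φ u) (φ v)⟩
  have hΦ : Continuous Φ := by
    refine Metric.continuous_iff.2 fun f ε hε => ?_
    obtain ⟨δ, hδ, h⟩ := hs (ε / 4) (by positivity)
    refine ⟨ε * δ / 4, by positivity, fun g hgf => ?_⟩
    have hgf' : ∀ z, dist (g.1 z) (f.1 z) ≤ ε * δ / 4 := fun z =>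
      (dist_coe_le_dist z).trans hgf.le
    have hle : dist (Φ g) (Φ f) ≤ ε / 2 := by
      rw [dist_eq_norm]
      refine LipZero.lipNumber_le (by positivity) fun x y => ?_
      show ‖(g.1 (φ x) - f.1 (φ x)) - (g.1 (φ y) - f.1 (φ y))‖ ≤ ε / 2 * dist x y
      rcases eq_or_ne x y with rfl | hne
      · simp
      have hxy := dist_pos.2 hne
      rcases lt_or_ge (dist x y) δ with hd | hd
      · have h1 := h x y hxy hd
        rw [div_lt_iff₀ hxy] at h1
        have h2 := hlip g (φ x) (φ y)
        have h3 := hlip f (φ x) (φ y)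
        rw [sub_sub_sub_comm]
        refine (norm_sub_le _ _).trans ?_
        rw [← dist_eq_norm, ← dist_eq_norm]
        linarith
      · refine (norm_sub_le _ _).trans ?_
        rw [← dist_eq_norm, ← dist_eq_norm]
        have h1 := hgf' (φ x)
        have h2 := hgf' (φ y)
        have h3 : ε * δ ≤ ε * dist x y := by gcongr
        linarith
    linarith
  refine ⟨range Φ, isCompact_range hΦ, ?_⟩
  filter_upwards [Metric.closedBall_mem_nhds (0 : littleLipZero 𝕜 x₀) one_pos] with f hf
  have hf1 : lipNumber f.1 ≤ 1 := mem_closedBall_zero_iff.1 hf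
  have hl : LipschitzWith 1 f.1 := LipschitzWith.of_dist_le_mul fun u v => by
    rw [dist_eq_norm, NNReal.coe_one]
    exact (f.1.norm_sub_le u v).trans (by gcongr)
  exact ⟨⟨BoundedContinuousFunction.mkOfCompact ⟨f.1, hl.continuous⟩, f.1.apply_base, hl⟩, rfl⟩

end Compactness

end LipschitzSpaces

end

theorem mainTheorem1 {X : Type*} [MetricSpace X] [CompactSpace X] (x₀ : X)
    {𝕜 : Type*} [RCLike 𝕜] (φ : X → X) (hφ : ∃ K, LipschitzWith K φ) (h0 : φ x₀ = x₀)
    (hsep : LipschitzSpaces.SeparatesPointsUniformly 𝕜 x₀)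
    (hweak : LipschitzSpaces.IsWeaklyCompactOperator (LipschitzSpaces.compOperator 𝕜 hφ h0)) :
    IsCompactOperator (LipschitzSpaces.compOperator 𝕜 hφ h0) :=
  (LipschitzSpaces.supercontractive_of_forall_comp hφ fun _ hf =>
    LipschitzSpaces.supercontractive_comp_of_isWeaklyCompactOperator hφ h0 hsep hweak
      hf).isCompactOperator_compOperator hφ h0
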